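/- Let $n\ge 1$ and let $\mathbb B^n=\{x\in\mathbb R^n:|x|<1\}$. The hyperbolic metric of $\mathbb B^n$ is $$\rho(x,y)=\inf_\gamma\int_\gamma\frac{2\,|dz|}{1-|z|^2},\qquad x,y\in\mathbb B^n,$$ where the infimum is over all rectifiable curves $\gamma$ in $\mathbb B^n$ joining $x$ and $y$. The chordal metric $q$ on $\overline{\mathbb R^n}=\mathbb R^n\cup\{\infty\}$ is the symmetric function given by $$q(x,y)=\frac{|x-y|}{\sqrt{1+|x|^2}\sqrt{1+|y|^2}}\ \ (x,y\in\mathbb R^n),\qquad q(x,\infty)=\frac1{\sqrt{1+|x|^2}}\ \ (x\in\mathbb R^n),\qquad q(\infty,\infty)=0.$$ Write $B_\rho(x,s)=\{y\in\mathbb B^n:\rho(x,y)<s\}$ and $B_q(x,r)=\{y\in\overline{\mathbb R^n}:q(x,y)<r\}$. Let $x\in\mathbb B^n$, and for $0<r<r_0:=\dfrac{1-|x|}{\sqrt{2(1+|x|^2)}}$ put $a=a(r)=1-r^2(1+|x|^2)$, $$m=m(r)=2\,\mathrm{arcsinh}\,\frac{r\left(\sqrt{1-r^2}-r|x|\right)(1+|x|^2)}{\sqrt{1-|x|^2}\;a\,\sqrt{1-a^{-2}\left(|x|-r\sqrt{1-r^2}\,(1+|x|^2)\right)^2}},$$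 $$M=M(r)=2\,\mathrm{arcsinh}\,\frac{r\left(\sqrt{1-r^2}+r|x|\right)(1+|x|^2)}{\sqrt{1-|x|^2}\;a\,\sqrt{1-a^{-2}\left(|x|+r\sqrt{1-r^2}\,(1+|x|^2)\right)^2}}.$$ Then for every $r\in(0,r_0)$ $$B_\rho(x,m)\subset B_q(x,r)\subset B_\rho(x,M),$$ and both inclusions are sharp: $m$ is the largest $s>0$ with $B_\rho(x,s)\subset B_q(x,r)$, and $M$ is the smallest $s>0$ with $B_q(x,r)\subset B_\rho(x,s)$. Moreover, for each fixed $x\in\mathbb B^n$, $M(r)/m(r)\to1$ as $r\to0^+$. -/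

import Mathlib

open Set Filter Topology

noncomputable section

namespace HypChordal

/-- The ambient Euclidean space `ℝⁿ`. -/
abbrev Space (n : ℕ) : Type := EuclideanSpace ℝ (Fin n)

/-- The open unit ball `𝔹ⁿ` of `ℝⁿ`. -/
def unitBall (n : ℕ) : Set (Space n) := Metric.ball 0 1

/-- `γ`, restricted to `[a, b]`, is a rectifiable curve (continuous, of finite length) that lies in
the unit ball and joins `x` to `y`. -/
structure IsRectifiableCurveJoining {n : ℕ} (γ : ℝ → Space n) (a b : ℝ) (x y : Space n) :
    Prop where
  le : a ≤ b
  continuousOn : ContinuousOn γ (Icc a b)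
  rectifiable : BoundedVariationOn γ (Icc a b)
  mapsTo : MapsTo γ (Icc a b) (unitBall n)
  source : γ a = x
  target : γ b = y

/-- The hyperbolic length `∫_γ 2 |dz| / (1 - |z|²)` of the curve `γ` on `[a, b]`.  The line integral
with respect to `|dz|` is, as usual for rectifiable curves, the integral over `[0, L]` of the
integrand along the arc length parametrization of `γ`, where `L` is the Euclidean length of `γ`. -/
def hyperbolicLength {n : ℕ} (γ : ℝ → Space n) (a b : ℝ) : ℝ :=
  ∫ t in (0 : ℝ)..(eVariationOn γ (Icc a b)).toReal,
    2 / (1 - ‖naturalParameterization γ (Icc a b) a t‖ ^ 2)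

/-- The hyperbolic metric `ρ` of the unit ball: the infimum of the hyperbolic lengths of the
rectifiable curves in the unit ball that join the two points. -/
def hyperbolicDist {n : ℕ} (x y : Space n) : ℝ :=
  sInf {l : ℝ | ∃ (γ : ℝ → Space n) (a b : ℝ),
    IsRectifiableCurveJoining γ a b x y ∧ l = hyperbolicLength γ a b}

/-- The hyperbolic ball `B_ρ(x, s)`, a subset of the unit ball. -/
def hyperbolicBall {n : ℕ} (x : Space n) (s : ℝ) : Set (Space n) :=
  {y | y ∈ unitBall n ∧ hyperbolicDist x y < s}

/-- The chordal metric `q` on `ℝⁿ ∪ {∞}`. -/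
def chordalDist {n : ℕ} : OnePoint (Space n) → OnePoint (Space n) → ℝ
  | OnePoint.some x, OnePoint.some y =>
      ‖x - y‖ / (Real.sqrt (1 + ‖x‖ ^ 2) * Real.sqrt (1 + ‖y‖ ^ 2))
  | OnePoint.some x, OnePoint.infty => 1 / Real.sqrt (1 + ‖x‖ ^ 2)
  | OnePoint.infty, OnePoint.some y => 1 / Real.sqrt (1 + ‖y‖ ^ 2)
  | OnePoint.infty, OnePoint.infty => 0

/-- The chordal ball `B_q(x, r)`, a subset of `ℝⁿ ∪ {∞}`. -/
def chordalBall {n : ℕ} (x : OnePoint (Space n)) (r : ℝ) : Set (OnePoint (Space n)) :=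
  {y | chordalDist x y < r}

/-- The number `a = 1 - r² (1 + |x|²)`. -/
def aux {n : ℕ} (x : Space n) (r : ℝ) : ℝ := 1 - r ^ 2 * (1 + ‖x‖ ^ 2)

/-- The inner radius `m`. -/
def innerRadius {n : ℕ} (x : Space n) (r : ℝ) : ℝ :=
  2 * Real.arsinh
    (r * (Real.sqrt (1 - r ^ 2) - r * ‖x‖) * (1 + ‖x‖ ^ 2) /
      (Real.sqrt (1 - ‖x‖ ^ 2) * aux x r *
        Real.sqrt (1 - (aux x r ^ 2)⁻¹ *
          (‖x‖ - r * Real.sqrt (1 - r ^ 2) * (1 + ‖x‖ ^ 2)) ^ 2)))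

/-- The outer radius `M`. -/
def outerRadius {n : ℕ} (x : Space n) (r : ℝ) : ℝ :=
  2 * Real.arsinh
    (r * (Real.sqrt (1 - r ^ 2) + r * ‖x‖) * (1 + ‖x‖ ^ 2) /
      (Real.sqrt (1 - ‖x‖ ^ 2) * aux x r *
        Real.sqrt (1 - (aux x r ^ 2)⁻¹ *
          (‖x‖ + r * Real.sqrt (1 - r ^ 2) * (1 + ‖x‖ ^ 2)) ^ 2)))

end HypChordal

end

/-! The hyperbolic metric has the closed form ρ = 2 arsinh √S, where S = |x-y|² / ((1-|x|²)(1-|y|²))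
(`hyperbolicDist_eq_poincareDist`). It bounds lengths from below because, away from y = x, its
gradient in y has norm exactly the density 2/(1-|y|²). It is attained by geodesics, which on the
hyperboloid are the curves cosh t · P + sinh t · U.

Put b = r²(1+|x|²). On the boundary of the chordal ball, |x-y|² = b(1+|y|²), so S = b/(1-|x|²) ·
(1+|y|²)/(1-|y|²), which increases with |y|. Hence the hyperbolically nearest and farthest boundary
points are those of least and greatest norm: the ends of the diameter through the origin. Their
signed distances t₁ < t₂ from the origin are the roots of (t-|x|)² = b(1+t²), and r < r₀ makes t₂ <
1. The radii m and M are the hyperbolic distances from x to these two ends, whence sharpness. For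
the inner inclusion, points with |y| < |t₁| need a separate argument
(`norm_sub_sq_lt_of_sinhSq_lt`).

As r → 0, both radii are 2 arsinh of r times factors with the same nonzero limit (1+|x|²)/(1-|x|²).
-/

namespace HypChordal

/-! ### The closed form as a lower bound for integrals along Lipschitz curves. -/

section Pointwise

variable {E : Type*} [NormedAddCommGroup E]

/-- The square of `sinh (ρ(x, y) / 2)` for the Poincaré metric `ρ` of the unit ball. -/
noncomputable def sinhSq (x y : E) : ℝ := ‖x - y‖ ^ 2 / ((1 - ‖x‖ ^ 2) * (1 - ‖y‖ ^ 2))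

/-- The closed form of the Poincaré metric of the unit ball. -/
noncomputable def poincareDist (x y : E) : ℝ := 2 * Real.arsinh (√(sinhSq x y))

lemma one_sub_normSq_pos {x : E} (hx : ‖x‖ < 1) : 0 < 1 - ‖x‖ ^ 2 := by
  nlinarith [norm_nonneg x]

lemma sinhSq_nonneg {x y : E} (hx : ‖x‖ < 1) (hy : ‖y‖ < 1) : 0 ≤ sinhSq x y := by
  have := one_sub_normSq_pos hx
  have := one_sub_normSq_pos hy
  unfold sinhSq
  positivity

lemma sinhSq_self (x : E) : sinhSq x x = 0 := by simp [sinhSq]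

lemma continuous_hyperbolicDensity {g : ℝ → E} (hg : Continuous g) (hb : ∀ t, ‖g t‖ < 1) :
    Continuous fun t => 2 / (1 - ‖g t‖ ^ 2) :=
  continuous_const.div (by fun_prop) fun t => (one_sub_normSq_pos (hb t)).ne'

variable [InnerProductSpace ℝ E]

/-- The gradient of `y ↦ sinhSq x y`. -/
noncomputable def sinhSqGrad (x y : E) : E :=
  (2 / ((1 - ‖x‖ ^ 2) * (1 - ‖y‖ ^ 2) ^ 2)) •
    ((1 - ‖y‖ ^ 2) • (y - x) + ‖x - y‖ ^ 2 • y)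

lemma hasFDerivAt_sinhSq {x y : E} (hx : ‖x‖ < 1) (hy : ‖y‖ < 1) :
    HasFDerivAt (sinhSq x) (innerSL ℝ (sinhSqGrad x y)) y := by
  have hA := one_sub_normSq_pos hx
  have hB := one_sub_normSq_pos hy
  have h1 : HasFDerivAt (fun y : E => ‖y - x‖ ^ 2) _ y :=
    ((hasFDerivAt_id y).sub_const x).norm_sq
  have h2 : HasFDerivAt (fun y : E => (1 - ‖x‖ ^ 2) * (1 - ‖y‖ ^ 2)) _ y :=
    ((hasFDerivAt_id y).norm_sq.const_sub 1).const_mul (1 - ‖x‖ ^ 2)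
  have h3 := h1.mul ((hasDerivAt_inv (by positivity)).comp_hasFDerivAt y h2)
  have h4 : sinhSq x = (fun y : E => ‖y - x‖ ^ 2) *
      (Inv.inv ∘ fun y : E => (1 - ‖x‖ ^ 2) * (1 - ‖y‖ ^ 2)) := by
    ext z
    simp [sinhSq, norm_sub_rev x z, div_eq_mul_inv]
  rw [h4]
  refine HasFDerivAt.congr_fderiv h3 ?_
  ext v
  simp [sinhSqGrad, norm_sub_rev x y]
  field_simp
  ring

/-- This is the eikonal equation: since ∇(2 arsinh √S) = ∇S / √(S(1+S)), it says that the gradient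
of the closed form has norm 2/(1-|y|²) where S ≠ 0. -/
lemma norm_sinhSqGrad_sq {x y : E} (hx : ‖x‖ < 1) (hy : ‖y‖ < 1) :
    ‖sinhSqGrad x y‖ ^ 2 =
      (2 / (1 - ‖y‖ ^ 2)) ^ 2 * (sinhSq x y * (1 + sinhSq x y)) := by
  have hA := one_sub_normSq_pos hx
  have hB := one_sub_normSq_pos hy
  have h1 : ‖x - y‖ ^ 2 = ‖x‖ ^ 2 - 2 * inner ℝ x y + ‖y‖ ^ 2 := norm_sub_sq_real x y
  have h2 : inner ℝ (y - x) y = ‖y‖ ^ 2 - inner ℝ x y := by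
    rw [inner_sub_left, real_inner_self_eq_norm_sq]
  have h3 : ‖(1 - ‖y‖ ^ 2) • (y - x) + ‖x - y‖ ^ 2 • y‖ ^ 2 =
      ‖x - y‖ ^ 2 * ((1 - ‖x‖ ^ 2) * (1 - ‖y‖ ^ 2) + ‖x - y‖ ^ 2) := by
    rw [norm_add_sq_real, norm_smul, norm_smul, inner_smul_left, inner_smul_right, h2,
      norm_sub_rev y x, mul_pow, mul_pow, Real.norm_eq_abs, Real.norm_eq_abs, sq_abs, sq_abs]
    simp only [conj_trivial]
    rw [h1]
    ring
  rw [sinhSqGrad, norm_smul, mul_pow, h3, Real.norm_eq_abs, sq_abs, sinhSq]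
  field_simp

/-- The square root is singular at y = x, where S = 0. Adding ε removes the singularity, and S(1+S)
≤ (S+ε)(1+S+ε) keeps the gradient below the density. -/
lemma hasFDerivAt_arsinh_sqrt_sinhSq {x y : E} (hx : ‖x‖ < 1) (hy : ‖y‖ < 1) {ε : ℝ}
    (hε : 0 < ε) : ∃ T : E →L[ℝ] ℝ, ‖T‖ ≤ 2 / (1 - ‖y‖ ^ 2) ∧
      HasFDerivAt (fun y => 2 * Real.arsinh (√(sinhSq x y + ε))) T y := by
  have hS := sinhSq_nonneg hx hy
  have hB := one_sub_normSq_pos hy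
  set S := sinhSq x y with hSdef
  refine ⟨_, ?_, ((((hasFDerivAt_sinhSq hx hy).add_const ε).sqrt
    (by rw [← hSdef]; positivity)).arsinh).const_mul 2⟩
  rw [← hSdef, Real.sq_sqrt (by positivity), norm_smul, norm_smul, norm_smul, innerSL_apply_norm]
  have h1 : ‖sinhSqGrad x y‖ = 2 / (1 - ‖y‖ ^ 2) * √(S * (1 + S)) := by
    rw [← Real.sqrt_sq (norm_nonneg _), norm_sinhSqGrad_sq hx hy, ← hSdef,
      Real.sqrt_mul (by positivity), Real.sqrt_sq (by positivity)]
  rw [h1]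
  have h2 : √(S * (1 + S)) ≤ √(1 + (S + ε)) * √(S + ε) := by
    rw [← Real.sqrt_mul (by positivity)]
    apply Real.sqrt_le_sqrt
    nlinarith
  have p1 : 0 < √(1 + (S + ε)) := by positivity
  have p2 : 0 < √(S + ε) := by positivity
  rw [Real.norm_of_nonneg (by norm_num), Real.norm_of_nonneg (by positivity),
    Real.norm_of_nonneg (by positivity)]
  calc 2 * ((√(1 + (S + ε)))⁻¹ * (1 / (2 * √(S + ε)) * (2 / (1 - ‖y‖ ^ 2) * √(S * (1 + S)))))
      = 2 / (1 - ‖y‖ ^ 2) * (√(S * (1 + S)) / (√(1 + (S + ε)) * √(S + ε))) := by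
        field_simp
    _ ≤ 2 / (1 - ‖y‖ ^ 2) * 1 := by
        gcongr
        rw [div_le_one (by positivity)]
        exact h2
    _ = _ := mul_one _

/-- A function with derivative of norm at most `C` has, along a `1`-Lipschitz curve, slopes whose
upper limit is at most `C`. -/
lemma eventually_slope_lt_of_hasFDerivAt {F : Type*} [NormedAddCommGroup F] [NormedSpace ℝ F]
    {g : ℝ → F} (hg : LipschitzWith 1 g) {h : F → ℝ} {T : F →L[ℝ] ℝ} {t : ℝ}
    (hT : HasFDerivAt h T (g t)) {r : ℝ} (hr : ‖T‖ < r) :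
    ∀ᶠ z in 𝓝[>] t, slope (h ∘ g) t z < r := by
  obtain ⟨δ, hδ, hδr⟩ : ∃ δ, 0 < δ ∧ ‖T‖ + δ < r := ⟨(r - ‖T‖) / 2, by linarith, by linarith⟩
  have h1 := (hg.continuous.tendsto t).eventually (hT.isLittleO.def hδ)
  filter_upwards [nhdsWithin_le_nhds h1, self_mem_nhdsWithin] with z hz htz
  have htz' : 0 < z - t := sub_pos.2 htz
  have h2 : ‖g z - g t‖ ≤ z - t := by
    have := hg.dist_le_mul z t
    rwa [dist_eq_norm, Real.dist_eq, abs_of_pos htz', NNReal.coe_one, one_mul] at this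
  have h3 : h (g z) - h (g t) ≤ (‖T‖ + δ) * ‖g z - g t‖ := by
    have h4 := (le_abs_self _).trans hz
    have h5 := (le_abs_self _).trans (T.le_opNorm (g z - g t))
    linarith
  rw [slope_def_field, div_lt_iff₀ htz']
  have : (‖T‖ + δ) * ‖g z - g t‖ ≤ (‖T‖ + δ) * (z - t) := by gcongr
  have h6 : (‖T‖ + δ) * (z - t) < r * (z - t) := by gcongr
  simp only [Function.comp_apply]
  linarith

/-- The curve need not be differentiable everywhere, so upper right slopes of the regularized
distance are compared with the density; then ε → 0. -/
theorem poincareDist_le_integral {g : ℝ → E} (hg : LipschitzWith 1 g) (hb : ∀ t, ‖g t‖ < 1)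
    {L : ℝ} (hL : 0 ≤ L) :
    poincareDist (g 0) (g L) ≤ ∫ t in (0 : ℝ)..L, 2 / (1 - ‖g t‖ ^ 2) := by
  have hφ := continuous_hyperbolicDensity hg.continuous hb
  have key : ∀ ε > 0, poincareDist (g 0) (g L) ≤
      2 * Real.arsinh (√ε) + ∫ t in (0 : ℝ)..L, 2 / (1 - ‖g t‖ ^ 2) := by
    intro ε hε
    set h : E → ℝ := fun y => 2 * Real.arsinh (√(sinhSq (g 0) y + ε)) with hh
    choose T hTn hT using fun t => hasFDerivAt_arsinh_sqrt_sinhSq (hb 0) (hb t) hε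
    have hB : ∀ t, HasDerivAt (fun u => 2 * Real.arsinh (√ε) +
        ∫ t in (0 : ℝ)..u, 2 / (1 - ‖g t‖ ^ 2)) (2 / (1 - ‖g t‖ ^ 2)) t := fun t =>
      (hφ.integral_hasStrictDerivAt 0 t).hasDerivAt.const_add _
    have hcont : Continuous (h ∘ g) := continuous_iff_continuousAt.2 fun t =>
      (hT t).continuousAt.comp hg.continuous.continuousAt
    have hmain := image_le_of_liminf_slope_right_le_deriv_boundary (f := h ∘ g) (a := 0) (b := L)
      hcont.continuousOn (B := fun u => 2 * Real.arsinh (√ε) +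
        ∫ t in (0 : ℝ)..u, 2 / (1 - ‖g t‖ ^ 2)) (by simp [hh, sinhSq_self])
      (fun t _ => (hB t).continuousAt.continuousWithinAt) (fun t _ => (hB t).hasDerivWithinAt)
      (fun t _ r hr => (eventually_slope_lt_of_hasFDerivAt hg (hT t)
        ((hTn t).trans_lt hr)).frequently) (right_mem_Icc.2 hL)
    refine le_trans ?_ hmain
    simp only [poincareDist, hh, Function.comp_apply]
    gcongr
    exact le_add_of_nonneg_right hε.le
  have hlim : Tendsto (fun ε : ℝ => 2 * Real.arsinh (√ε) +
      ∫ t in (0 : ℝ)..L, 2 / (1 - ‖g t‖ ^ 2)) (𝓝[>] 0)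
      (𝓝 (2 * Real.arsinh (√0) + ∫ t in (0 : ℝ)..L, 2 / (1 - ‖g t‖ ^ 2))) := by
    refine tendsto_nhdsWithin_of_tendsto_nhds (Continuous.tendsto ?_ 0)
    exact ((Real.continuous_arsinh.comp Real.continuous_sqrt).const_mul 2).add continuous_const
  simpa using ge_of_tendsto hlim (by filter_upwards [self_mem_nhdsWithin] with ε hε using key ε hε)

end Pointwise

/-! ### Arc length parametrization of continuous curves of finite length. -/

section ArcLength

variable {E : Type*} [MetricSpace E] {γ : ℝ → E} {a b : ℝ}

/-- A jump of the variation function at `t` equals a jump of `γ` there, and `γ` has none. -/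
lemma continuousOn_variationOnFromTo (hγ : ContinuousOn γ (Icc a b))
    (hv : BoundedVariationOn γ (Icc a b)) :
    ContinuousOn (variationOnFromTo γ (Icc a b) a) (Icc a b) := by
  intro t ht
  have ha : a ∈ Icc a b := ⟨le_rfl, ht.1.trans ht.2⟩
  have hl := variationOnFromTo.tendsto_left ha ht hv.locallyBoundedVariationOn
    ((hγ t ht).tendsto.mono_left (nhdsWithin_mono _ inter_subset_left))
  have hr := variationOnFromTo.tendsto_right ha ht hv.locallyBoundedVariationOn
    ((hγ t ht).tendsto.mono_left (nhdsWithin_mono _ inter_subset_left))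
  simp only [dist_self, sub_zero, add_zero] at hl hr
  have h : Icc a b = (Icc a b ∩ Iio t ∪ {t}) ∪ Icc a b ∩ Ioi t := by
    ext s
    simp only [mem_union, mem_inter_iff, mem_Icc, mem_Iio, mem_Ioi, mem_singleton_iff]
    rcases lt_trichotomy s t with h | h | h <;> grind
  unfold ContinuousWithinAt
  nth_rewrite 2 [h]
  rw [nhdsWithin_union, nhdsWithin_union, nhdsWithin_singleton]
  exact ((hl.sup (tendsto_pure_nhds _ _)).sup hr)

lemma variationOnFromTo_right_eq (hab : a ≤ b) :
    variationOnFromTo γ (Icc a b) a b = (eVariationOn γ (Icc a b)).toReal := by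
  rw [variationOnFromTo.eq_of_le _ _ hab, inter_self]

lemma variationOnFromTo_image_Icc (hab : a ≤ b) (hγ : ContinuousOn γ (Icc a b))
    (hv : BoundedVariationOn γ (Icc a b)) :
    variationOnFromTo γ (Icc a b) a '' Icc a b =
      Icc 0 (eVariationOn γ (Icc a b)).toReal := by
  rw [← variationOnFromTo_right_eq hab, ← variationOnFromTo.self γ (Icc a b) a]
  apply Subset.antisymm
  · rintro _ ⟨t, ht, rfl⟩
    have hm := variationOnFromTo.monotoneOn hv.locallyBoundedVariationOn (left_mem_Icc.2 hab)
    exact ⟨hm (left_mem_Icc.2 hab) ht ht.1, hm ht (right_mem_Icc.2 hab) ht.2⟩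
  · exact intermediate_value_Icc hab (continuousOn_variationOnFromTo hγ hv)

lemma naturalParameterization_variationOnFromTo (hv : BoundedVariationOn γ (Icc a b)) {t : ℝ}
    (ht : t ∈ Icc a b) :
    naturalParameterization γ (Icc a b) a (variationOnFromTo γ (Icc a b) a t) = γ t :=
  edist_eq_zero.1 (edist_naturalParameterization_eq_zero hv.locallyBoundedVariationOn
    ⟨le_rfl, ht.1.trans ht.2⟩ ht)

/-- The arc length parametrization, extended to the whole line by constants. -/
noncomputable def arcLengthExtend (γ : ℝ → E) (a b : ℝ) (t : ℝ) : E :=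
  naturalParameterization γ (Icc a b) a
    (projIcc 0 (eVariationOn γ (Icc a b)).toReal ENNReal.toReal_nonneg t)

lemma arcLengthExtend_of_mem {t : ℝ} (ht : t ∈ Icc 0 (eVariationOn γ (Icc a b)).toReal) :
    arcLengthExtend γ a b t = naturalParameterization γ (Icc a b) a t := by
  rw [arcLengthExtend, projIcc_of_mem _ ht]

lemma exists_arcLengthExtend_eq (hab : a ≤ b) (hγ : ContinuousOn γ (Icc a b))
    (hv : BoundedVariationOn γ (Icc a b)) (t : ℝ) :
    ∃ s ∈ Icc a b, arcLengthExtend γ a b t = γ s := by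
  have h := (projIcc 0 (eVariationOn γ (Icc a b)).toReal ENNReal.toReal_nonneg t).2
  obtain ⟨s, hs, hst⟩ := (variationOnFromTo_image_Icc hab hγ hv).symm.subset h
  exact ⟨s, hs, by rw [arcLengthExtend, ← hst, naturalParameterization_variationOnFromTo hv hs]⟩

lemma arcLengthExtend_variationOnFromTo (hab : a ≤ b) (hγ : ContinuousOn γ (Icc a b))
    (hv : BoundedVariationOn γ (Icc a b)) {t : ℝ} (ht : t ∈ Icc a b) :
    arcLengthExtend γ a b (variationOnFromTo γ (Icc a b) a t) = γ t := by
  rw [arcLengthExtend_of_mem, naturalParameterization_variationOnFromTo hv ht]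
  rw [← variationOnFromTo_image_Icc hab hγ hv]
  exact mem_image_of_mem _ ht

/-- Unit speed makes the length of the arc between two parameters equal to their difference, and
length dominates distance; the clamping projection is itself 1-Lipschitz. -/
lemma lipschitzWith_arcLengthExtend (hab : a ≤ b) (hγ : ContinuousOn γ (Icc a b))
    (hv : BoundedVariationOn γ (Icc a b)) : LipschitzWith 1 (arcLengthExtend γ a b) := by
  have h1 := has_unit_speed_naturalParameterization γ hv.locallyBoundedVariationOn
    (left_mem_Icc.2 hab)
  rw [variationOnFromTo_image_Icc hab hγ hv] at h1
  have h2 : LipschitzOnWith 1 (naturalParameterization γ (Icc a b) a)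
      (Icc 0 (eVariationOn γ (Icc a b)).toReal) := by
    intro s hs t ht
    wlog hst : s ≤ t generalizing s t
    · rw [edist_comm, edist_comm s]
      exact this ht hs (le_of_not_ge hst)
    calc _ ≤ eVariationOn (naturalParameterization γ (Icc a b) a)
          (Icc 0 (eVariationOn γ (Icc a b)).toReal ∩ Icc s t) :=
        eVariationOn.edist_le _ ⟨hs, le_rfl, hst⟩ ⟨ht, hst, le_rfl⟩
      _ = _ := by
        rw [h1 hs ht, edist_comm, edist_dist, Real.dist_eq, abs_of_nonneg (sub_nonneg.2 hst)]
        simp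
  have h3 := h2.to_restrict.comp
    (LipschitzWith.projIcc (ENNReal.toReal_nonneg (a := eVariationOn γ (Icc a b))))
  rwa [one_mul] at h3

end ArcLength

lemma hyperbolicLength_eq {n : ℕ} (γ : ℝ → Space n) (a b : ℝ) :
    hyperbolicLength γ a b = ∫ t in (0 : ℝ)..(eVariationOn γ (Icc a b)).toReal,
      2 / (1 - ‖arcLengthExtend γ a b t‖ ^ 2) := by
  refine intervalIntegral.integral_congr fun t ht => ?_
  rw [uIcc_of_le ENNReal.toReal_nonneg] at ht
  simp only [arcLengthExtend_of_mem ht]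

theorem poincareDist_le_hyperbolicLength {n : ℕ} {γ : ℝ → Space n} {a b : ℝ} {x y : Space n}
    (h : IsRectifiableCurveJoining γ a b x y) :
    poincareDist x y ≤ hyperbolicLength γ a b := by
  have h0 := arcLengthExtend_variationOnFromTo h.le h.continuousOn h.rectifiable
    (left_mem_Icc.2 h.le)
  have h1 := arcLengthExtend_variationOnFromTo h.le h.continuousOn h.rectifiable
    (right_mem_Icc.2 h.le)
  rw [variationOnFromTo.self, h.source] at h0
  rw [variationOnFromTo_right_eq h.le, h.target] at h1
  rw [hyperbolicLength_eq, ← h0, ← h1]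
  refine poincareDist_le_integral
    (lipschitzWith_arcLengthExtend h.le h.continuousOn h.rectifiable) (fun t => ?_)
    ENNReal.toReal_nonneg
  obtain ⟨s, hs, hst⟩ := exists_arcLengthExtend_eq h.le h.continuousOn h.rectifiable t
  rw [hst]
  simpa [unitBall] using h.mapsTo hs

end HypChordal

namespace HypChordal

/-! ### Curves of unit hyperbolic speed: length at most elapsed time. -/

section UnitHyperbolicSpeed

variable {n : ℕ} {c c' : ℝ → Space n}

lemma variationOnFromTo_le_mul {E : Type*} [MetricSpace E] {γ : ℝ → E} {s : Set ℝ} {t z : ℝ}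
    (htz : t ≤ z) {K : NNReal} (hK : LipschitzOnWith K γ (Icc t z)) :
    variationOnFromTo γ s t z ≤ K * (z - t) := by
  rw [variationOnFromTo.eq_of_le _ _ htz]
  have h1 := (eVariationOn.mono γ (inter_subset_right (s := s) (t := Icc t z))).trans
    (hK.comp_eVariationOn_le (g := id) (s := Icc t z) (mapsTo_id _))
  rw [eVariationOn_id_Icc] at h1
  have h2 := ENNReal.toReal_mono (by finiteness) h1
  rwa [ENNReal.toReal_mul, ENNReal.toReal_ofReal (sub_nonneg.2 htz), ENNReal.coe_toReal] at h2

lemma lipschitzOnWith_of_hasDerivAt_le (hc : ∀ t, HasDerivAt c (c' t) t) {s : Set ℝ}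
    (hs : Convex ℝ s) {K : ℝ} (hK0 : 0 ≤ K) (hK : ∀ t ∈ s, ‖c' t‖ ≤ K) :
    LipschitzOnWith ⟨K, hK0⟩ c s :=
  hs.lipschitzOnWith_of_nnnorm_hasDerivWithin_le (fun t _ => (hc t).hasDerivWithinAt) hK

lemma isRectifiableCurveJoining_of_unitSpeed (hc : ∀ t, HasDerivAt c (c' t) t)
    (hb : ∀ t, ‖c t‖ < 1) (hspeed : ∀ t, ‖c' t‖ = (1 - ‖c t‖ ^ 2) / 2) {d : ℝ} (hd : 0 ≤ d) :
    IsRectifiableCurveJoining c 0 d (c 0) (c d) where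
  le := hd
  continuousOn := fun t _ => (hc t).continuousAt.continuousWithinAt
  rectifiable := by
    have h1 : LipschitzOnWith ⟨1, zero_le_one⟩ c (Icc 0 d) :=
      lipschitzOnWith_of_hasDerivAt_le hc (convex_Icc 0 d) zero_le_one fun t _ => by
        rw [hspeed]
        nlinarith [norm_nonneg (c t)]
    have h2 := h1.locallyBoundedVariationOn 0 d (left_mem_Icc.2 hd) (right_mem_Icc.2 hd)
    rwa [inter_self] at h2
  mapsTo := fun t _ => by simpa [unitBall] using hb t
  source := rfl
  target := rfl

/-- The length up to time t is `G ∘ V`, with `V` the Euclidean arc length and `G` the integral of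
the density. Only an upper bound is needed, so `V` is not differentiated: near t it is Lipschitz
with constant close to the speed `A`, while `G` has slope `A⁻¹` at `V t`. The product bounds the
upper slope by 1. -/
theorem hyperbolicLength_le_of_unitSpeed (hc : ∀ t, HasDerivAt c (c' t) t)
    (hb : ∀ t, ‖c t‖ < 1) (hspeed : ∀ t, ‖c' t‖ = (1 - ‖c t‖ ^ 2) / 2) {d : ℝ} (hd : 0 ≤ d) :
    hyperbolicLength c 0 d ≤ d := by
  obtain ⟨-, hcont, hv, -, -, -⟩ := isRectifiableCurveJoining_of_unitSpeed hc hb hspeed hd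
  set V := variationOnFromTo c (Icc 0 d) 0 with hV
  set g := arcLengthExtend c 0 d with hg
  have hgV : ∀ t ∈ Icc 0 d, g (V t) = c t := fun t ht =>
    arcLengthExtend_variationOnFromTo hd hcont hv ht
  have hgb : ∀ t, ‖g t‖ < 1 := fun t => by
    obtain ⟨s, -, hs⟩ := exists_arcLengthExtend_eq hd hcont hv t
    rw [hg, hs]
    exact hb s
  have hφ := continuous_hyperbolicDensity (lipschitzWith_arcLengthExtend hd hcont hv).continuous hgb
  set G : ℝ → ℝ := fun u => ∫ t in (0 : ℝ)..u, 2 / (1 - ‖g t‖ ^ 2) with hG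
  have hGd : ∀ u, HasDerivAt G (2 / (1 - ‖g u‖ ^ 2)) u := fun u =>
    (hφ.integral_hasStrictDerivAt 0 u).hasDerivAt
  have hVc : ContinuousOn V (Icc 0 d) := continuousOn_variationOnFromTo hcont hv
  have hWc : ContinuousOn (G ∘ V) (Icc 0 d) := fun t ht =>
    (hGd (V t)).continuousAt.comp_continuousWithinAt (hVc t ht)
  have hlen : hyperbolicLength c 0 d = (G ∘ V) d := by
    rw [hyperbolicLength_eq, Function.comp_apply, hV, variationOnFromTo_right_eq hd]
  rw [hlen]
  refine image_le_of_liminf_slope_right_le_deriv_boundary (f := G ∘ V) (a := 0) (b := d)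
      hWc (B := id) (B' := fun _ => 1) (by simp [hG, hV, variationOnFromTo.self]) continuousOn_id
      (fun t _ => (hasDerivAt_id t).hasDerivWithinAt) (fun t ht r hr => ?_) (right_mem_Icc.2 hd)
  refine Eventually.frequently ?_
  have ht' : t ∈ Icc 0 d := Ico_subset_Icc_self ht
  set A := (1 - ‖c t‖ ^ 2) / 2 with hA
  have hApos : 0 < A := by
    have := one_sub_normSq_pos (hb t)
    positivity
  have hden : 2 / (1 - ‖g (V t)‖ ^ 2) = A⁻¹ := by rw [hgV t ht', hA, inv_div]
  -- Here r > 1, and the product tends to 1 as η → 0; η is the common error for the slopes of `G`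
  -- and `V`.
  obtain ⟨η, hη, hη0⟩ : ∃ η, (A⁻¹ + η) * (A + η) < r ∧ 0 < η := by
    have h1 : Tendsto (fun η : ℝ => (A⁻¹ + η) * (A + η)) (𝓝[>] 0) (𝓝 ((A⁻¹ + 0) * (A + 0))) :=
      tendsto_nhdsWithin_of_tendsto_nhds (Continuous.tendsto (by fun_prop) 0)
    rw [add_zero, add_zero, inv_mul_cancel₀ hApos.ne'] at h1
    exact ((h1.eventually_lt_const hr).and self_mem_nhdsWithin).exists
  have hVt : Tendsto V (𝓝[>] t) (𝓝 (V t)) :=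
    (hVc t ht').mono_left (nhdsWithin_le_of_mem (Icc_mem_nhdsGT_of_mem ht))
  have e1 := hVt.eventually ((hGd (V t)).isLittleO.def hη0)
  have e2 : ∀ᶠ s in 𝓝 t, (1 - ‖c s‖ ^ 2) / 2 < A + η := by
    have : ContinuousAt (fun s => (1 - ‖c s‖ ^ 2) / 2) t := by
      have := (hc t).continuousAt
      fun_prop
    exact this.eventually_lt_const (by simp only [← hA]; linarith)
  obtain ⟨δ, hδ, hδc⟩ := Metric.eventually_nhds_iff.1 e2
  have e3 : Ioo t (t + δ) ∈ 𝓝[>] t := Ioo_mem_nhdsGT (by linarith)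
  have e4 : Icc 0 d ∈ 𝓝[>] t := Icc_mem_nhdsGT_of_mem ht
  filter_upwards [e1, e3, e4] with z hz1 hz2 hz3
  have htz : 0 < z - t := sub_pos.2 hz2.1
  have hK0 : 0 ≤ A + η := by positivity
  have hVz : V z - V t ≤ (A + η) * (z - t) := by
    rw [hV, variationOnFromTo.sub_right hv.locallyBoundedVariationOn (left_mem_Icc.2 hd) hz3 ht']
    refine variationOnFromTo_le_mul hz2.1.le (lipschitzOnWith_of_hasDerivAt_le hc
      (convex_Icc t z) hK0 fun s hs => ?_)
    rw [hspeed]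
    refine (hδc ?_).le
    rw [Real.dist_eq, abs_of_nonneg (sub_nonneg.2 hs.1)]
    linarith [hs.2, hz2.2]
  have hVmono : 0 ≤ V z - V t := by
    rw [hV, variationOnFromTo.sub_right hv.locallyBoundedVariationOn (left_mem_Icc.2 hd) hz3 ht']
    exact variationOnFromTo.nonneg_of_le _ _ hz2.1.le
  rw [slope_def_field, div_lt_iff₀ htz, Function.comp_apply, Function.comp_apply]
  have h5 := (le_abs_self _).trans hz1
  rw [hden, smul_eq_mul, Real.norm_of_nonneg hVmono] at h5
  have h6 : G (V z) - G (V t) ≤ (A⁻¹ + η) * (V z - V t) := by linarith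
  have h7 : (A⁻¹ + η) * (V z - V t) ≤ (A⁻¹ + η) * ((A + η) * (z - t)) := by gcongr
  have h8 : (A⁻¹ + η) * (A + η) * (z - t) < r * (z - t) := by gcongr
  linarith

end UnitHyperbolicSpeed

/-! ### Geodesics from the hyperboloid model. -/

section Hyperboloid

variable {E : Type*} [NormedAddCommGroup E]

lemma cosh_poincareDist {x y : E} (hx : ‖x‖ < 1) (hy : ‖y‖ < 1) :
    Real.cosh (poincareDist x y) = 1 + 2 * sinhSq x y := by
  rw [poincareDist, Real.cosh_two_mul, Real.cosh_sq, Real.sinh_arsinh,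
    Real.sq_sqrt (sinhSq_nonneg hx hy)]
  ring

lemma poincareDist_pos {x y : E} (hx : ‖x‖ < 1) (hy : ‖y‖ < 1) (hxy : x ≠ y) :
    0 < poincareDist x y := by
  have h1 := one_sub_normSq_pos hx
  have h2 := one_sub_normSq_pos hy
  have h3 : 0 < ‖x - y‖ := norm_pos_iff.2 (sub_ne_zero.2 hxy)
  have h4 : 0 < sinhSq x y := by unfold sinhSq; positivity
  have h5 := Real.arsinh_pos_iff.2 (Real.sqrt_pos.2 h4)
  unfold poincareDist
  positivity

lemma poincareDist_nonneg (x y : E) : 0 ≤ poincareDist x y :=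
  mul_nonneg zero_le_two (Real.arsinh_nonneg_iff.2 (Real.sqrt_nonneg _))

variable [InnerProductSpace ℝ E]

/-- The point of the unit ball that corresponds to the point `(X, X₀)` of the hyperboloid
`X₀² - |X|² = 1`, `X₀ > 0`. -/
noncomputable def ballOfHyperboloid (X : E) (X₀ : ℝ) : E := (1 + X₀)⁻¹ • X

lemma norm_ballOfHyperboloid_sq {X : E} {X₀ : ℝ} (h : ‖X‖ ^ 2 = X₀ ^ 2 - 1) (h0 : 0 < X₀) :
    1 - ‖ballOfHyperboloid X X₀‖ ^ 2 = 2 / (1 + X₀) := by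
  rw [ballOfHyperboloid, norm_smul, mul_pow, h, Real.norm_eq_abs, sq_abs]
  field_simp
  ring

lemma norm_ballOfHyperboloid_lt_one {X : E} {X₀ : ℝ} (h : ‖X‖ ^ 2 = X₀ ^ 2 - 1) (h0 : 0 < X₀) :
    ‖ballOfHyperboloid X X₀‖ < 1 := by
  have h1 := norm_ballOfHyperboloid_sq h h0
  have h2 : 0 < 2 / (1 + X₀) := by positivity
  nlinarith [norm_nonneg (ballOfHyperboloid X X₀)]

lemma hasDerivAt_ballOfHyperboloid {X : ℝ → E} {X₀ : ℝ → ℝ} {X' : E} {X₀' t : ℝ}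
    (hX : HasDerivAt X X' t) (hX₀ : HasDerivAt X₀ X₀' t) (h0 : 0 < X₀ t) :
    HasDerivAt (fun t => ballOfHyperboloid (X t) (X₀ t))
      ((1 + X₀ t)⁻¹ • X' - (X₀' / (1 + X₀ t) ^ 2) • X t) t := by
  have h1 := ((hX₀.const_add 1).inv (by positivity)).smul hX
  refine HasDerivAt.congr_deriv h1 ?_
  rw [neg_div, neg_smul, ← sub_eq_add_neg]
  rfl

/-- The hypotheses say that the velocity is Lorentz-orthogonal to the position and has Lorentz norm
1. By `norm_ballOfHyperboloid_sq` the resulting Euclidean speed is (1-|c|²)/2, i.e. unit hyperbolic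
speed in the ball. -/
lemma norm_deriv_ballOfHyperboloid {X X' : E} {X₀ X₀' : ℝ} (h : ‖X‖ ^ 2 = X₀ ^ 2 - 1)
    (h' : ‖X'‖ ^ 2 = 1 + X₀' ^ 2) (hXX' : inner ℝ X X' = X₀ * X₀') (h0 : 0 < X₀) :
    ‖(1 + X₀)⁻¹ • X' - (X₀' / (1 + X₀) ^ 2) • X‖ = 1 / (1 + X₀) := by
  rw [← sq_eq_sq₀ (norm_nonneg _) (by positivity), norm_sub_sq_real, norm_smul, norm_smul, mul_pow,
    mul_pow, inner_smul_left, inner_smul_right, real_inner_comm, hXX', h, h', Real.norm_eq_abs,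
    Real.norm_eq_abs, sq_abs, sq_abs]
  simp only [conj_trivial]
  field_simp
  ring

variable {p u : E} {p₀ u₀ : ℝ}

lemma norm_cosh_add_sinh_sq (hp : ‖p‖ ^ 2 = p₀ ^ 2 - 1) (hu : ‖u‖ ^ 2 = 1 + u₀ ^ 2)
    (hpu : inner ℝ p u = p₀ * u₀) (t : ℝ) :
    ‖Real.cosh t • p + Real.sinh t • u‖ ^ 2 =
      (Real.cosh t * p₀ + Real.sinh t * u₀) ^ 2 - 1 := by
  rw [norm_add_sq_real, norm_smul, norm_smul, mul_pow, mul_pow, inner_smul_left, inner_smul_right,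
    hpu, hp, hu, Real.norm_eq_abs, Real.norm_eq_abs, sq_abs, sq_abs]
  simp only [conj_trivial]
  linear_combination -Real.cosh_sq_sub_sinh_sq t

lemma norm_sinh_add_cosh_sq (hp : ‖p‖ ^ 2 = p₀ ^ 2 - 1) (hu : ‖u‖ ^ 2 = 1 + u₀ ^ 2)
    (hpu : inner ℝ p u = p₀ * u₀) (t : ℝ) :
    ‖Real.sinh t • p + Real.cosh t • u‖ ^ 2 =
      1 + (Real.sinh t * p₀ + Real.cosh t * u₀) ^ 2 := by
  rw [norm_add_sq_real, norm_smul, norm_smul, mul_pow, mul_pow, inner_smul_left, inner_smul_right,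
    hpu, hp, hu, Real.norm_eq_abs, Real.norm_eq_abs, sq_abs, sq_abs]
  simp only [conj_trivial]
  linear_combination Real.cosh_sq_sub_sinh_sq t

lemma inner_cosh_add_sinh (hp : ‖p‖ ^ 2 = p₀ ^ 2 - 1) (hu : ‖u‖ ^ 2 = 1 + u₀ ^ 2)
    (hpu : inner ℝ p u = p₀ * u₀) (t : ℝ) :
    inner ℝ (Real.cosh t • p + Real.sinh t • u) (Real.sinh t • p + Real.cosh t • u) =
      (Real.cosh t * p₀ + Real.sinh t * u₀) * (Real.sinh t * p₀ + Real.cosh t * u₀) := by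
  simp only [inner_add_left, inner_add_right, inner_smul_left, inner_smul_right,
    real_inner_self_eq_norm_sq, real_inner_comm p u, hpu, hp, hu, conj_trivial]
  ring

/-- The curve stays on the upper sheet: Cauchy–Schwarz for `p` and `u` gives u₀² ≤ p₀² - 1, and
|sinh t| < cosh t. -/
lemma cosh_add_sinh_pos (hp : ‖p‖ ^ 2 = p₀ ^ 2 - 1) (hp₀ : 0 < p₀) (hu : ‖u‖ ^ 2 = 1 + u₀ ^ 2)
    (hpu : inner ℝ p u = p₀ * u₀) (t : ℝ) : 0 < Real.cosh t * p₀ + Real.sinh t * u₀ := by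
  have h1 : |u₀| < p₀ := by
    have h2 : (p₀ * u₀) ^ 2 ≤ ‖p‖ ^ 2 * ‖u‖ ^ 2 := by
      rw [← hpu, ← mul_pow, ← sq_abs]
      exact pow_le_pow_left₀ (abs_nonneg _) (abs_real_inner_le_norm p u) 2
    rw [hp, hu] at h2
    exact abs_lt_of_sq_lt_sq (by nlinarith) hp₀.le
  have h3 : |Real.sinh t| < Real.cosh t :=
    abs_lt_of_sq_lt_sq (by nlinarith [Real.cosh_sq t]) (Real.cosh_pos t).le
  have h4 : |Real.sinh t * u₀| < Real.cosh t * p₀ := by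
    rw [abs_mul]
    exact mul_lt_mul'' h3 h1 (abs_nonneg _) (abs_nonneg _)
  linarith [neg_abs_le (Real.sinh t * u₀)]

lemma ballOfHyperboloid_two_smul {x : E} (hx : ‖x‖ < 1) :
    ballOfHyperboloid ((2 / (1 - ‖x‖ ^ 2)) • x) ((1 + ‖x‖ ^ 2) / (1 - ‖x‖ ^ 2)) = x := by
  have h := one_sub_normSq_pos hx
  rw [ballOfHyperboloid, smul_smul]
  convert one_smul ℝ x
  field_simp
  ring

lemma norm_two_smul_sq {x : E} (hx : ‖x‖ < 1) :
    ‖(2 / (1 - ‖x‖ ^ 2)) • x‖ ^ 2 = ((1 + ‖x‖ ^ 2) / (1 - ‖x‖ ^ 2)) ^ 2 - 1 := by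
  have h := one_sub_normSq_pos hx
  rw [norm_smul, mul_pow, Real.norm_eq_abs, sq_abs]
  field_simp
  ring

/-- Any two points of the unit ball are joined by a geodesic of unit hyperbolic speed. -/
theorem exists_unitSpeed_geodesic {x y : E} (hx : ‖x‖ < 1) (hy : ‖y‖ < 1) (hxy : x ≠ y) :
    ∃ c c' : ℝ → E, (∀ t, HasDerivAt c (c' t) t) ∧ (∀ t, ‖c t‖ < 1) ∧
      (∀ t, ‖c' t‖ = (1 - ‖c t‖ ^ 2) / 2) ∧ c 0 = x ∧ c (poincareDist x y) = y := by
  have hA := one_sub_normSq_pos hx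
  have hB := one_sub_normSq_pos hy
  set d := poincareDist x y with hd
  have hs : 0 < Real.sinh d := Real.sinh_pos_iff.2 (poincareDist_pos hx hy hxy)
  set p : E := (2 / (1 - ‖x‖ ^ 2)) • x with hpdef
  set p₀ : ℝ := (1 + ‖x‖ ^ 2) / (1 - ‖x‖ ^ 2) with hp₀def
  set q : E := (2 / (1 - ‖y‖ ^ 2)) • y with hqdef
  set q₀ : ℝ := (1 + ‖y‖ ^ 2) / (1 - ‖y‖ ^ 2) with hq₀def
  have hp : ‖p‖ ^ 2 = p₀ ^ 2 - 1 := norm_two_smul_sq hx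
  have hq : ‖q‖ ^ 2 = q₀ ^ 2 - 1 := norm_two_smul_sq hy
  have hp₀ : 0 < p₀ := by positivity
  have hC : Real.cosh d = p₀ * q₀ - inner ℝ p q := by
    rw [hd, cosh_poincareDist hx hy, sinhSq, norm_sub_sq_real, hpdef, hqdef, inner_smul_left,
      inner_smul_right, hp₀def, hq₀def]
    simp only [conj_trivial]
    field_simp
    ring
  have hbx : ballOfHyperboloid p p₀ = x := ballOfHyperboloid_two_smul hx
  have hby : ballOfHyperboloid q q₀ = y := ballOfHyperboloid_two_smul hy
  have hCS := Real.cosh_sq d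
  clear_value p p₀ q q₀
  set C := Real.cosh d with hCdef
  set s := Real.sinh d with hsdef
  -- The initial velocity is forced by cosh d · P + sinh d · U = Q; the division by sinh d is why x
  -- ≠ y is assumed.
  set u : E := s⁻¹ • (q - C • p) with hudef
  set u₀ : ℝ := s⁻¹ * (q₀ - C * p₀) with hu₀def
  have hpq : inner ℝ p q = p₀ * q₀ - C := by linarith
  have hu : ‖u‖ ^ 2 = 1 + u₀ ^ 2 := by
    rw [hudef, norm_smul, mul_pow, norm_sub_sq_real, norm_smul, mul_pow, inner_smul_right,
      real_inner_comm, hpq, hp, hq, Real.norm_eq_abs, Real.norm_eq_abs, sq_abs, sq_abs, hu₀def]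
    field_simp
    linear_combination hCS
  have hpu : inner ℝ p u = p₀ * u₀ := by
    rw [hudef, inner_smul_right, inner_sub_right, inner_smul_right, real_inner_self_eq_norm_sq, hp,
      hpq, hu₀def]
    ring
  have hX₀ := cosh_add_sinh_pos hp hp₀ hu hpu
  refine ⟨fun t => ballOfHyperboloid (Real.cosh t • p + Real.sinh t • u)
    (Real.cosh t * p₀ + Real.sinh t * u₀), _, fun t => hasDerivAt_ballOfHyperboloid
      (((Real.hasDerivAt_cosh t).smul_const p).add ((Real.hasDerivAt_sinh t).smul_const u))
      (((Real.hasDerivAt_cosh t).mul_const p₀).add ((Real.hasDerivAt_sinh t).mul_const u₀))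
      (hX₀ t), fun t => norm_ballOfHyperboloid_lt_one (norm_cosh_add_sinh_sq hp hu hpu t) (hX₀ t),
      fun t => ?_, ?_, ?_⟩
  · rw [norm_ballOfHyperboloid_sq (norm_cosh_add_sinh_sq hp hu hpu t) (hX₀ t)]
    refine (norm_deriv_ballOfHyperboloid (norm_cosh_add_sinh_sq hp hu hpu t)
      (norm_sinh_add_cosh_sq hp hu hpu t) (inner_cosh_add_sinh hp hu hpu t) (hX₀ t)).trans ?_
    have := hX₀ t
    field_simp
  · simpa using hbx
  · have h1 : C • p + s • u = q := by
      rw [hudef, smul_smul, mul_inv_cancel₀ hs.ne', one_smul, add_sub_cancel]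
    have h2 : C * p₀ + s * u₀ = q₀ := by
      rw [hu₀def]
      field_simp
      ring
    simp only [← hCdef, ← hsdef, h1, h2]
    exact hby

end Hyperboloid

/-- The closed form bounds every length from below, and a geodesic (a constant curve if x = y) has
at most that length. -/
theorem hyperbolicDist_eq_poincareDist {n : ℕ} {x y : Space n} (hx : ‖x‖ < 1) (hy : ‖y‖ < 1) :
    hyperbolicDist x y = poincareDist x y := by
  have hlow : ∀ l ∈ {l : ℝ | ∃ (γ : ℝ → Space n) (a b : ℝ),
      IsRectifiableCurveJoining γ a b x y ∧ l = hyperbolicLength γ a b}, poincareDist x y ≤ l := by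
    rintro l ⟨γ, a, b, hγ, rfl⟩
    exact poincareDist_le_hyperbolicLength hγ
  obtain ⟨γ, a, b, hγ, hl⟩ : ∃ (γ : ℝ → Space n) (a b : ℝ),
      IsRectifiableCurveJoining γ a b x y ∧ hyperbolicLength γ a b ≤ poincareDist x y := by
    rcases eq_or_ne x y with rfl | hxy
    · refine ⟨fun _ => x, 0, 0, ⟨le_rfl, continuousOn_const,
        BoundedVariationOn.of_subsingleton (by simp), fun _ _ => by simpa [unitBall] using hx,
        rfl, rfl⟩, ?_⟩
      rw [hyperbolicLength, eVariationOn.subsingleton _ (by simp), ENNReal.toReal_zero,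
        intervalIntegral.integral_same]
      exact poincareDist_nonneg x x
    · obtain ⟨c, c', hc, hb, hspeed, h0, h1⟩ := exists_unitSpeed_geodesic hx hy hxy
      have hd := poincareDist_nonneg x y
      have hjoin := isRectifiableCurveJoining_of_unitSpeed hc hb hspeed hd
      rw [h0, h1] at hjoin
      exact ⟨c, 0, _, hjoin, hyperbolicLength_le_of_unitSpeed hc hb hspeed hd⟩
  exact le_antisymm ((csInf_le ⟨_, hlow⟩ ⟨γ, a, b, hγ, rfl⟩).trans hl)
    (le_csInf ⟨_, γ, a, b, hγ, rfl⟩ hlow)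

end HypChordal

namespace HypChordal

/-! ### The quadratic for the diameter ends, and the small-radius limit. -/

section Real

/-- The quantities attached to a chordal ball centred at distance `k` from the origin, of radius
`r < (1 - k) / √(2 (1 + k²))`: the denominator `a` and the signed distances `t₁ < t₂` from the
origin of the end points of its diameter through the origin. -/
structure IsChordalDiameter (k r a t₁ t₂ : ℝ) : Prop where
  nonneg : 0 ≤ k
  lt_one : k < 1
  pos : 0 < r
  a_pos : 0 < a
  t₁_lt : t₁ < k
  lt_t₂ : k < t₂
  t₂_lt_one : t₂ < 1
  neg_t₂_le : -t₂ ≤ t₁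
  factor : ∀ t, (t - k) ^ 2 - r ^ 2 * (1 + k ^ 2) * (1 + t ^ 2) = a * ((t - t₁) * (t - t₂))

lemma two_mul_sq_lt_of_lt_div {k r : ℝ} (hr : 0 < r)
    (hr0 : r < (1 - k) / √(2 * (1 + k ^ 2))) : 2 * (r ^ 2 * (1 + k ^ 2)) < (1 - k) ^ 2 := by
  have h1 : 0 < √(2 * (1 + k ^ 2)) := by positivity
  rw [lt_div_iff₀ h1] at hr0
  have h2 := pow_lt_pow_left₀ hr0 (by positivity) two_ne_zero
  rw [mul_pow, Real.sq_sqrt (by positivity)] at h2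
  linarith

lemma isChordalDiameter {k r : ℝ} (hk : 0 ≤ k) (hk1 : k < 1) (hr : 0 < r)
    (hr0 : r < (1 - k) / √(2 * (1 + k ^ 2))) :
    IsChordalDiameter k r (1 - r ^ 2 * (1 + k ^ 2))
      ((k - r * √(1 - r ^ 2) * (1 + k ^ 2)) / (1 - r ^ 2 * (1 + k ^ 2)))
      ((k + r * √(1 - r ^ 2) * (1 + k ^ 2)) / (1 - r ^ 2 * (1 + k ^ 2))) := by
  have h1 := two_mul_sq_lt_of_lt_div hr hr0
  have ha : 0 < 1 - r ^ 2 * (1 + k ^ 2) := by nlinarith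
  have hr2 : r ^ 2 < 1 := by nlinarith [sq_nonneg (r * k)]
  have hw : √(1 - r ^ 2) ^ 2 = 1 - r ^ 2 := Real.sq_sqrt (by linarith)
  have hw0 : 0 < √(1 - r ^ 2) := Real.sqrt_pos.2 (by linarith)
  set w := √(1 - r ^ 2)
  set a := 1 - r ^ 2 * (1 + k ^ 2) with hadef
  set N := r * w * (1 + k ^ 2) with hN
  have hN0 : 0 < N := by positivity
  have hfac : ∀ t, (t - k) ^ 2 - r ^ 2 * (1 + k ^ 2) * (1 + t ^ 2) =
      a * ((t - (k - N) / a) * (t - (k + N) / a)) := by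
    intro t
    -- This is the product of the roots of a t² - 2kt + k² - r²(1+k²), multiplied by a².
    have hNN : k ^ 2 - N ^ 2 = a * (k ^ 2 - r ^ 2 * (1 + k ^ 2)) := by
      rw [hN, mul_pow, mul_pow, hw, hadef]
      ring
    have : a * ((t - (k - N) / a) * (t - (k + N) / a)) =
        a * t ^ 2 - 2 * k * t + (k ^ 2 - N ^ 2) / a := by
      field_simp
      ring
    rw [this, hNN, mul_div_cancel_left₀ _ ha.ne', hadef]
    ring
  have hle : (k - N) / a < (k + N) / a := by gcongr; linarith
  -- The quadratic is negative at t = k, so k lies strictly between the roots.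
  have hkk : (k - (k - N) / a) * (k - (k + N) / a) < 0 := by
    have h2 := hfac k
    have h3 : 0 < r ^ 2 * (1 + k ^ 2) * (1 + k ^ 2) := by positivity
    by_contra! h4
    nlinarith [mul_nonneg ha.le h4]
  have hk₁ : (k - N) / a < k := by
    by_contra! h
    nlinarith [mul_nonneg (sub_nonneg.2 h) (sub_nonneg.2 (h.trans hle.le))]
  have hk₂ : k < (k + N) / a := by
    by_contra! h
    nlinarith [mul_nonneg (sub_nonneg.2 h) (sub_nonneg.2 hk₁.le)]
  refine ⟨hk, hk1, hr, ha, hk₁, hk₂, ?_, ?_, hfac⟩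
  -- Otherwise 1 would lie between the roots, but r < r₀ makes the quadratic positive at t = 1.
  · by_contra! h
    have h2 := hfac 1
    have h3 := mul_nonneg ha.le (mul_nonneg (sub_nonneg.2 (hk₁.trans hk1).le) (sub_nonneg.2 h))
    nlinarith
  · rw [← neg_div]
    gcongr
    linarith

namespace IsChordalDiameter

variable {k r a t₁ t₂ : ℝ} (h : IsChordalDiameter k r a t₁ t₂)

include h

lemma one_sub_sq_pos : 0 < 1 - k ^ 2 := by nlinarith [h.nonneg, h.lt_one]

lemma one_sub_t₁_sq_pos : 0 < 1 - t₁ ^ 2 := by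
  nlinarith [h.t₁_lt, h.lt_one, h.neg_t₂_le, h.t₂_lt_one]

lemma one_sub_t₂_sq_pos : 0 < 1 - t₂ ^ 2 := by
  nlinarith [h.nonneg, h.lt_t₂, h.t₂_lt_one]

lemma sq_t₁ : (t₁ - k) ^ 2 = r ^ 2 * (1 + k ^ 2) * (1 + t₁ ^ 2) := by
  linarith [h.factor t₁, show a * ((t₁ - t₁) * (t₁ - t₂)) = 0 by ring]

lemma sq_t₂ : (t₂ - k) ^ 2 = r ^ 2 * (1 + k ^ 2) * (1 + t₂ ^ 2) := by
  linarith [h.factor t₂, show a * ((t₂ - t₁) * (t₂ - t₂)) = 0 by ring]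

lemma sq_lt_iff {t : ℝ} : (t - k) ^ 2 < r ^ 2 * (1 + k ^ 2) * (1 + t ^ 2) ↔ t₁ < t ∧ t < t₂ := by
  have h1 := h.t₁_lt.trans h.lt_t₂
  rw [← sub_neg, h.factor, mul_neg_iff]
  constructor
  · rintro (⟨-, h2⟩ | ⟨h2, -⟩)
    · rcases mul_neg_iff.1 h2 with h3 | h3
      · exact ⟨by linarith, by linarith⟩
      · linarith
    · linarith [h.a_pos]
  · rintro ⟨h2, h3⟩
    exact Or.inl ⟨h.a_pos, mul_neg_of_pos_of_neg (by linarith) (by linarith)⟩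

end IsChordalDiameter

/-- Continuity of `A` at 0 alone gives r · A(r) the derivative A(0) there, and arsinh has derivative
1 at 0. -/
lemma tendsto_arsinh_mul_div {A : ℝ → ℝ} (hA : ContinuousAt A 0) :
    Tendsto (fun r => Real.arsinh (r * A r) / r) (𝓝[>] 0) (𝓝 (A 0)) := by
  have h1 : HasDerivAt (fun r => r * A r) (A 0) 0 := by
    rw [hasDerivAt_iff_tendsto_slope]
    refine (hA.tendsto.mono_left nhdsWithin_le_nhds).congr' ?_
    filter_upwards [self_mem_nhdsWithin] with r hr
    have : r ≠ 0 := hr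
    simp [slope_def_field, this]
  have h2 := h1.arsinh
  rw [hasDerivAt_iff_tendsto_slope] at h2
  simp only [zero_mul, ne_eq, OfNat.ofNat_ne_zero, not_false_eq_true, zero_pow, add_zero,
    Real.sqrt_one, inv_one, one_smul] at h2
  refine (h2.mono_left (nhdsWithin_mono _ fun r hr => (mem_Ioi.1 hr).ne')).congr fun r => ?_
  simp [slope_def_field]

/-- The argument of `arsinh` in the inner (`σ = -1`) and outer (`σ = 1`) radius, divided by `r`. -/
noncomputable def radiusFactor (k σ r : ℝ) : ℝ :=
  (√(1 - r ^ 2) + σ * (r * k)) * (1 + k ^ 2) /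
    (√(1 - k ^ 2) * (1 - r ^ 2 * (1 + k ^ 2)) *
      √(1 - ((1 - r ^ 2 * (1 + k ^ 2)) ^ 2)⁻¹ * (k + σ * (r * √(1 - r ^ 2) * (1 + k ^ 2))) ^ 2))

lemma radiusFactor_zero (k σ : ℝ) :
    radiusFactor k σ 0 = (1 + k ^ 2) / (√(1 - k ^ 2) * √(1 - k ^ 2)) := by
  simp [radiusFactor]

lemma continuousAt_radiusFactor {k : ℝ} (hk : k ^ 2 < 1) (σ : ℝ) :
    ContinuousAt (radiusFactor k σ) 0 := by
  have h1 : √(1 - k ^ 2) ≠ 0 := (Real.sqrt_pos.2 (by linarith)).ne'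
  have h2 : ContinuousAt (fun r : ℝ => ((1 - r ^ 2 * (1 + k ^ 2)) ^ 2)⁻¹) 0 :=
    ContinuousAt.inv₀ (by fun_prop) (by simp)
  refine ContinuousAt.div (by fun_prop) (by fun_prop) ?_
  simpa using h1

end Real

/-! ### Comparing hyperbolic and chordal distances. -/

section Comparison

variable {E : Type*} [NormedAddCommGroup E] {x y : E} {r a t₁ t₂ : ℝ}

/-- The value of `sinhSq` at two points of a diameter, at signed distances `k` and `t` from the
origin. -/
noncomputable def diamSinhSq (k t : ℝ) : ℝ := (t - k) ^ 2 / ((1 - k ^ 2) * (1 - t ^ 2))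

/-- Outside the chordal ball S is at least b/(1-|x|²) · (1+|y|²)/(1-|y|²), with equality on the
boundary, and this increases with |y|. -/
lemma le_sinhSq_of_mul_le (hx : ‖x‖ < 1) (hy : ‖y‖ < 1) {b t : ℝ} (hb : 0 ≤ b) (ht : t ^ 2 < 1)
    (hty : t ^ 2 ≤ ‖y‖ ^ 2) (h : b * (1 + ‖y‖ ^ 2) ≤ ‖x - y‖ ^ 2)
    (hbt : (t - ‖x‖) ^ 2 = b * (1 + t ^ 2)) : diamSinhSq ‖x‖ t ≤ sinhSq x y := by
  have hA := one_sub_normSq_pos hx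
  have hB := one_sub_normSq_pos hy
  have ht' : 0 < 1 - t ^ 2 := by linarith
  rw [diamSinhSq, sinhSq, hbt, ← div_div, ← div_div, div_right_comm, div_right_comm (‖x - y‖ ^ 2)]
  gcongr ?_ / _
  calc b * (1 + t ^ 2) / (1 - t ^ 2) ≤ b * (1 + ‖y‖ ^ 2) / (1 - ‖y‖ ^ 2) := by gcongr
    _ ≤ _ := by gcongr

lemma sinhSq_lt_of_lt_mul (hx : ‖x‖ < 1) {b t : ℝ} (hb : 0 ≤ b) (ht : t ^ 2 < 1)
    (hty : ‖y‖ ^ 2 ≤ t ^ 2) (h : ‖x - y‖ ^ 2 < b * (1 + ‖y‖ ^ 2))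
    (hbt : (t - ‖x‖) ^ 2 = b * (1 + t ^ 2)) : sinhSq x y < diamSinhSq ‖x‖ t := by
  have hA := one_sub_normSq_pos hx
  have ht' : 0 < 1 - t ^ 2 := by linarith
  have hB : 0 < 1 - ‖y‖ ^ 2 := by linarith
  rw [diamSinhSq, sinhSq, hbt, ← div_div, ← div_div, div_right_comm,
    div_right_comm (b * (1 + t ^ 2))]
  gcongr ?_ / _
  calc _ < b * (1 + ‖y‖ ^ 2) / (1 - ‖y‖ ^ 2) := by gcongr
    _ ≤ b * (1 + t ^ 2) / (1 - t ^ 2) := by gcongr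

lemma diamSinhSq_le_sinhSq_of_norm_le (hx : ‖x‖ < 1) {t : ℝ} (hyt : ‖y‖ ≤ t) (htx : t ≤ ‖x‖) :
    diamSinhSq ‖x‖ t ≤ sinhSq x y := by
  have hA := one_sub_normSq_pos hx
  have hy0 := norm_nonneg y
  have ht' : 0 < 1 - t ^ 2 := by nlinarith
  have hB : 0 < 1 - ‖y‖ ^ 2 := by nlinarith
  have h1 : (‖x‖ - ‖y‖) ^ 2 ≤ ‖x - y‖ ^ 2 :=
    pow_le_pow_left₀ (by linarith) (norm_sub_norm_le x y) 2
  rw [diamSinhSq, sinhSq, div_le_div_iff₀ (by positivity) (by positivity)]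
  have h2 : (t - ‖x‖) ^ 2 * (1 - ‖y‖ ^ 2) ≤ (‖x‖ - ‖y‖) ^ 2 * (1 - t ^ 2) := by
    -- This product is the difference of the two sides of `h2`, factored.
    have h3 : 0 ≤ (t - ‖y‖) * ((‖x‖ - ‖y‖) * (1 - ‖x‖ * t) + (‖x‖ - t) * (1 - ‖x‖ * ‖y‖)) := by
      have h4 : 0 ≤ 1 - ‖x‖ * t := by nlinarith
      have h5 : 0 ≤ 1 - ‖x‖ * ‖y‖ := by nlinarith
      have h6 : 0 ≤ t - ‖y‖ := by linarith
      have h7 : 0 ≤ ‖x‖ - ‖y‖ := by linarith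
      have h8 : 0 ≤ ‖x‖ - t := by linarith
      positivity
    linarith
  have h3 : (‖x‖ - ‖y‖) ^ 2 * (1 - t ^ 2) ≤ ‖x - y‖ ^ 2 * (1 - t ^ 2) := by gcongr
  have h4 := mul_le_mul_of_nonneg_left (h2.trans h3) hA.le
  linarith

namespace IsChordalDiameter

variable (h : IsChordalDiameter ‖x‖ r a t₁ t₂)

include h

/-- Let y lie outside the chordal ball. If |y| ≥ |t₁|, monotonicity in |y| applies. If |y| < t₁,
then y is separated from x by the sphere of radius t₁ about the origin, so it is at least as far as
the nearer end. If |y| < -t₁, even the point of norm |y| farthest from x lies in the chordal ball, a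
contradiction. -/
lemma norm_sub_sq_lt_of_sinhSq_lt (hy : ‖y‖ < 1) (hxy : sinhSq x y < diamSinhSq ‖x‖ t₁) :
    ‖x - y‖ ^ 2 < r ^ 2 * (1 + ‖x‖ ^ 2) * (1 + ‖y‖ ^ 2) := by
  by_contra! hle
  have ht := h.one_sub_t₁_sq_pos
  rcases le_or_gt (t₁ ^ 2) (‖y‖ ^ 2) with hty | hty
  · exact hxy.not_ge (le_sinhSq_of_mul_le h.lt_one hy (by positivity) (by linarith) hty hle h.sq_t₁)
  rcases le_or_gt 0 t₁ with h0 | h0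
  · exact hxy.not_ge (diamSinhSq_le_sinhSq_of_norm_le h.lt_one
      (abs_le_of_sq_le_sq' hty.le h0).2 h.t₁_lt.le)
  · have h1 : ‖y‖ < -t₁ := by nlinarith [norm_nonneg y]
    have h2 : (-‖y‖ - ‖x‖) ^ 2 < r ^ 2 * (1 + ‖x‖ ^ 2) * (1 + (-‖y‖) ^ 2) :=
      h.sq_lt_iff.2 ⟨by linarith, by linarith [norm_nonneg y, h.nonneg, h.lt_t₂]⟩
    have h3 : ‖x - y‖ ^ 2 ≤ (‖x‖ + ‖y‖) ^ 2 :=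
      pow_le_pow_left₀ (norm_nonneg _) (norm_sub_le x y) 2
    rw [neg_sq] at h2
    nlinarith

lemma norm_lt_of_norm_sub_sq_lt
    (hxy : ‖x - y‖ ^ 2 < r ^ 2 * (1 + ‖x‖ ^ 2) * (1 + ‖y‖ ^ 2)) : ‖y‖ < t₂ := by
  have h1 : (‖y‖ - ‖x‖) ^ 2 ≤ ‖x - y‖ ^ 2 := by
    rw [sq_le_sq, abs_norm, norm_sub_rev]
    exact abs_norm_sub_norm_le y x
  exact (h.sq_lt_iff.1 (h1.trans_lt hxy)).2

lemma sinhSq_lt_of_norm_sub_sq_lt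
    (hxy : ‖x - y‖ ^ 2 < r ^ 2 * (1 + ‖x‖ ^ 2) * (1 + ‖y‖ ^ 2)) :
    sinhSq x y < diamSinhSq ‖x‖ t₂ := by
  have h1 := h.norm_lt_of_norm_sub_sq_lt hxy
  exact sinhSq_lt_of_lt_mul h.lt_one (by positivity) (by linarith [h.one_sub_t₂_sq_pos])
    (pow_le_pow_left₀ (norm_nonneg _) h1.le 2) hxy h.sq_t₂

end IsChordalDiameter

end Comparison

/-! ### Membership in the balls, and points on the diameter. -/

section Chordal

variable {n : ℕ} {x y : Space n} {r : ℝ}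

lemma coe_mem_chordalBall_iff (hr : 0 < r) :
    (y : OnePoint (Space n)) ∈ chordalBall (x : OnePoint (Space n)) r ↔
      ‖x - y‖ ^ 2 < r ^ 2 * (1 + ‖x‖ ^ 2) * (1 + ‖y‖ ^ 2) := by
  change ‖x - y‖ / (√(1 + ‖x‖ ^ 2) * √(1 + ‖y‖ ^ 2)) < r ↔ _
  rw [div_lt_iff₀ (by positivity), ← sq_lt_sq₀ (norm_nonneg _) (by positivity), mul_pow, mul_pow,
    Real.sq_sqrt (by positivity), Real.sq_sqrt (by positivity), mul_assoc]

lemma infty_notMem_chordalBall (hr : 0 < r) (h : r ^ 2 * (1 + ‖x‖ ^ 2) ≤ 1) :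
    OnePoint.infty ∉ chordalBall (x : OnePoint (Space n)) r := by
  change ¬ (1 / √(1 + ‖x‖ ^ 2) < r)
  rw [not_lt, le_div_iff₀ (by positivity), ← sq_le_sq₀ (by positivity) zero_le_one, mul_pow,
    Real.sq_sqrt (by positivity), one_pow]
  exact h

lemma norm_sub_smul_sq {e : Space n} (he : ‖e‖ = 1) (hxe : x = ‖x‖ • e) (t : ℝ) :
    ‖x - t • e‖ ^ 2 = (t - ‖x‖) ^ 2 := by
  have h1 : x - t • e = (‖x‖ - t) • e := by
    rw [sub_smul, ← hxe]
  rw [h1, norm_smul, he, mul_one, Real.norm_eq_abs, sq_abs]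
  ring

lemma sinhSq_smul {e : Space n} (he : ‖e‖ = 1) (hxe : x = ‖x‖ • e) (t : ℝ) :
    sinhSq x (t • e) = diamSinhSq ‖x‖ t := by
  rw [sinhSq, diamSinhSq, norm_sub_smul_sq he hxe, norm_smul, he, mul_one, Real.norm_eq_abs, sq_abs]

lemma exists_direction (hn : 1 ≤ n) (x : Space n) : ∃ e : Space n, ‖e‖ = 1 ∧ x = ‖x‖ • e := by
  rcases eq_or_ne x 0 with rfl | hx
  · exact ⟨EuclideanSpace.single ⟨0, hn⟩ 1, by simp, by simp⟩
  · have : ‖x‖ ≠ 0 := norm_ne_zero_iff.2 hx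
    exact ⟨‖x‖⁻¹ • x, by simp [norm_smul, this], by simp [smul_smul, this]⟩

lemma arsinh_radius_eq {k a t b : ℝ} (hk : k ^ 2 < 1) (ha : 0 < a)
    (hb : 0 ≤ b) (hbt : (t / a - k) ^ 2 = (b / a) ^ 2) :
    b / (√(1 - k ^ 2) * a * √(1 - (a ^ 2)⁻¹ * t ^ 2)) = √(diamSinhSq k (t / a)) := by
  have h1 : 1 - (a ^ 2)⁻¹ * t ^ 2 = 1 - (t / a) ^ 2 := by
    rw [div_pow]
    ring
  rw [diamSinhSq, hbt, h1, Real.sqrt_div (by positivity), Real.sqrt_sq (by positivity),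
    Real.sqrt_mul (by linarith), div_div]
  congr 1
  ring

lemma poincareDist_lt_iff {s : ℝ} (hx : ‖x‖ < 1) (hy : ‖y‖ < 1) :
    poincareDist x y < 2 * Real.arsinh (√s) ↔ sinhSq x y < s := by
  rw [poincareDist, mul_lt_mul_iff_right₀ two_pos, Real.arsinh_lt_arsinh,
    Real.sqrt_lt_sqrt_iff (sinhSq_nonneg hx hy)]

lemma mem_hyperbolicBall_iff {s : ℝ} (hx : ‖x‖ < 1) :
    y ∈ hyperbolicBall x s ↔ ‖y‖ < 1 ∧ poincareDist x y < s := by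
  have h1 : y ∈ unitBall n ↔ ‖y‖ < 1 := by simp [unitBall]
  rw [hyperbolicBall, mem_ofPred_eq, h1]
  exact and_congr_right fun hy => by rw [hyperbolicDist_eq_poincareDist hx hy]

end Chordal

/-! ### The radii as hyperbolic distances to the diameter ends, and their ratio. -/

section Radii

variable {n : ℕ} {x : Space n} {r : ℝ}

/-- The signed distance from the origin of the end point closest to it of the diameter through the
origin of a chordal ball. -/
noncomputable def innerEnd (x : Space n) (r : ℝ) : ℝ :=
  (‖x‖ - r * √(1 - r ^ 2) * (1 + ‖x‖ ^ 2)) / aux x r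

/-- The distance from the origin of the end point farthest from it of the diameter through the
origin of a chordal ball. -/
noncomputable def outerEnd (x : Space n) (r : ℝ) : ℝ :=
  (‖x‖ + r * √(1 - r ^ 2) * (1 + ‖x‖ ^ 2)) / aux x r

lemma isChordalDiameter_ends (hx : ‖x‖ < 1) (hr : 0 < r)
    (hr0 : r < (1 - ‖x‖) / √(2 * (1 + ‖x‖ ^ 2))) :
    IsChordalDiameter ‖x‖ r (aux x r) (innerEnd x r) (outerEnd x r) :=
  isChordalDiameter (norm_nonneg x) hx hr hr0

/-- Needed for the numerator in `innerRadius` to be nonnegative, so that it is the root of its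
square. -/
lemma mul_norm_le_sqrt (h : 0 ≤ aux x r) : r * ‖x‖ ≤ √(1 - r ^ 2) := by
  apply Real.le_sqrt_of_sq_le
  rw [aux] at h
  nlinarith

lemma innerRadius_eq (h : IsChordalDiameter ‖x‖ r (aux x r) (innerEnd x r) (outerEnd x r)) :
    innerRadius x r = 2 * Real.arsinh (√(diamSinhSq ‖x‖ (innerEnd x r))) := by
  have ha := h.a_pos
  have hr := h.pos
  have h1 := mul_norm_le_sqrt ha.le
  rw [innerRadius, arsinh_radius_eq (by linarith [h.one_sub_sq_pos]) ha
    (by have := sub_nonneg.2 h1; positivity)]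
  · rfl
  · rw [← neg_sq]
    congr 1
    field_simp
    rw [aux]
    ring

lemma outerRadius_eq (h : IsChordalDiameter ‖x‖ r (aux x r) (innerEnd x r) (outerEnd x r)) :
    outerRadius x r = 2 * Real.arsinh (√(diamSinhSq ‖x‖ (outerEnd x r))) := by
  have ha := h.a_pos
  have hr := h.pos
  rw [outerRadius, arsinh_radius_eq (by linarith [h.one_sub_sq_pos]) ha
    (by positivity)]
  · rfl
  · congr 1
    field_simp
    rw [aux]
    ring

lemma innerRadius_eq_radiusFactor (x : Space n) (r : ℝ) :
    innerRadius x r = 2 * Real.arsinh (r * radiusFactor ‖x‖ (-1) r) := by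
  simp only [innerRadius, radiusFactor, aux, neg_one_mul, ← sub_eq_add_neg]
  rw [← mul_div_assoc, mul_assoc r]

lemma outerRadius_eq_radiusFactor (x : Space n) (r : ℝ) :
    outerRadius x r = 2 * Real.arsinh (r * radiusFactor ‖x‖ 1 r) := by
  simp only [outerRadius, radiusFactor, aux, one_mul]
  rw [← mul_div_assoc, mul_assoc r]

lemma tendsto_outerRadius_div_innerRadius (hx : ‖x‖ < 1) :
    Tendsto (fun r => outerRadius x r / innerRadius x r) (𝓝[>] 0) (𝓝 1) := by
  have hk : ‖x‖ ^ 2 < 1 := by linarith [one_sub_normSq_pos hx]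
  have h1 := tendsto_arsinh_mul_div (continuousAt_radiusFactor hk 1)
  have h2 := tendsto_arsinh_mul_div (continuousAt_radiusFactor hk (-1))
  rw [radiusFactor_zero] at h1 h2
  have h0 : (1 + ‖x‖ ^ 2) / (√(1 - ‖x‖ ^ 2) * √(1 - ‖x‖ ^ 2)) ≠ 0 := by
    have : 0 < 1 - ‖x‖ ^ 2 := by linarith
    positivity
  have h3 := h1.div h2 h0
  rw [div_self h0] at h3
  refine h3.congr' ?_
  filter_upwards [self_mem_nhdsWithin] with r hr
  rw [Pi.div_apply, outerRadius_eq_radiusFactor, innerRadius_eq_radiusFactor,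
    mul_div_mul_left _ _ two_ne_zero, div_div_div_cancel_right₀ (mem_Ioi.1 hr).ne']

end Radii

/-! ### The inclusions and their sharpness. -/

section Sharpness

variable {n : ℕ} {x : Space n} {r : ℝ}

lemma image_hyperbolicBall_subset_chordalBall
    (h : IsChordalDiameter ‖x‖ r (aux x r) (innerEnd x r) (outerEnd x r)) :
    ((↑) : Space n → OnePoint (Space n)) '' hyperbolicBall x (innerRadius x r) ⊆
      chordalBall (x : OnePoint (Space n)) r := by
  rintro _ ⟨y, hy, rfl⟩
  rw [mem_hyperbolicBall_iff h.lt_one] at hy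
  rw [innerRadius_eq h, poincareDist_lt_iff h.lt_one hy.1] at hy
  exact (coe_mem_chordalBall_iff h.pos).2 (h.norm_sub_sq_lt_of_sinhSq_lt hy.1 hy.2)

lemma chordalBall_subset_image_hyperbolicBall
    (h : IsChordalDiameter ‖x‖ r (aux x r) (innerEnd x r) (outerEnd x r)) :
    chordalBall (x : OnePoint (Space n)) r ⊆
      ((↑) : Space n → OnePoint (Space n)) '' hyperbolicBall x (outerRadius x r) := by
  intro y hy
  induction y using OnePoint.rec with
  | infty =>
    refine absurd hy (infty_notMem_chordalBall h.pos ?_)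
    linarith [h.a_pos, aux.eq_1 x r]
  | coe y =>
    rw [coe_mem_chordalBall_iff h.pos] at hy
    have hy1 := (h.norm_lt_of_norm_sub_sq_lt hy).trans h.t₂_lt_one
    refine mem_image_of_mem _ ((mem_hyperbolicBall_iff h.lt_one).2 ⟨hy1, ?_⟩)
    rw [outerRadius_eq h, poincareDist_lt_iff h.lt_one hy1]
    exact h.sinhSq_lt_of_norm_sub_sq_lt hy

lemma arsinh_sqrt_diamSinhSq_pos {k t : ℝ} (hk : 0 < 1 - k ^ 2) (ht : 0 < 1 - t ^ 2)
    (hkt : t - k ≠ 0) : 0 < 2 * Real.arsinh (√(diamSinhSq k t)) := by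
  have h1 : 0 < diamSinhSq k t := by unfold diamSinhSq; positivity
  have h2 := Real.arsinh_pos_iff.2 (Real.sqrt_pos.2 h1)
  positivity

/-- The inner end of the diameter is at hyperbolic distance exactly m but lies on the chordal
sphere, hence outside the open chordal ball. -/
lemma le_innerRadius_of_subset (hn : 1 ≤ n)
    (h : IsChordalDiameter ‖x‖ r (aux x r) (innerEnd x r) (outerEnd x r)) {s : ℝ}
    (hs : ((↑) : Space n → OnePoint (Space n)) '' hyperbolicBall x s ⊆
      chordalBall (x : OnePoint (Space n)) r) : s ≤ innerRadius x r := by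
  by_contra! hlt
  obtain ⟨e, he, hxe⟩ := exists_direction hn x
  have hnorm : ‖innerEnd x r • e‖ ^ 2 = innerEnd x r ^ 2 := by
    rw [norm_smul, he, mul_one, Real.norm_eq_abs, sq_abs]
  have hb : ‖innerEnd x r • e‖ < 1 := by
    have := h.one_sub_t₁_sq_pos
    nlinarith [norm_nonneg (innerEnd x r • e)]
  have h1 : innerEnd x r • e ∈ hyperbolicBall x s := by
    rw [mem_hyperbolicBall_iff h.lt_one]
    refine ⟨hb, ?_⟩
    rwa [poincareDist, sinhSq_smul he hxe, ← innerRadius_eq h]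
  have h2 := (coe_mem_chordalBall_iff h.pos).1 (hs (mem_image_of_mem _ h1))
  rw [norm_sub_smul_sq he hxe, hnorm, h.sq_t₁] at h2
  exact lt_irrefl _ h2

/-- The outer end is not in the open chordal ball, so it is approached along the diameter from
inside and the distance bound passes to the limit. -/
lemma outerRadius_le_of_subset (hn : 1 ≤ n)
    (h : IsChordalDiameter ‖x‖ r (aux x r) (innerEnd x r) (outerEnd x r)) {s : ℝ}
    (hs : chordalBall (x : OnePoint (Space n)) r ⊆
      ((↑) : Space n → OnePoint (Space n)) '' hyperbolicBall x s) : outerRadius x r ≤ s := by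
  obtain ⟨e, he, hxe⟩ := exists_direction hn x
  have key : ∀ t, ‖x‖ < t → t < outerEnd x r → 2 * Real.arsinh (√(diamSinhSq ‖x‖ t)) ≤ s := by
    intro t ht₁ ht₂
    have h1 : ((t • e : Space n) : OnePoint (Space n)) ∈ chordalBall (x : OnePoint (Space n)) r := by
      rw [coe_mem_chordalBall_iff h.pos, norm_sub_smul_sq he hxe, norm_smul, he, mul_one,
        Real.norm_eq_abs, sq_abs]
      exact h.sq_lt_iff.2 ⟨h.t₁_lt.trans ht₁, ht₂⟩
    obtain ⟨y, hy, hyt⟩ := hs h1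
    rw [OnePoint.coe_injective hyt] at hy
    have h2 := ((mem_hyperbolicBall_iff h.lt_one).1 hy).2
    rw [poincareDist, sinhSq_smul he hxe] at h2
    exact h2.le
  have hcont : ContinuousAt (fun t => 2 * Real.arsinh (√(diamSinhSq ‖x‖ t))) (outerEnd x r) := by
    have h1 : ContinuousAt (diamSinhSq ‖x‖) (outerEnd x r) :=
      ContinuousAt.div (by fun_prop) (by fun_prop)
        (mul_pos h.one_sub_sq_pos h.one_sub_t₂_sq_pos).ne'
    exact (Real.continuous_arsinh.continuousAt.comp h1.sqrt).const_mul 2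
  rw [outerRadius_eq h]
  refine le_of_tendsto (hcont.tendsto.mono_left (nhdsWithin_le_nhds (s := Iio (outerEnd x r)))) ?_
  filter_upwards [Ioo_mem_nhdsLT h.lt_t₂] with t ht using key t ht.1 ht.2

end Sharpness

end HypChordal

theorem theorem3p8 (n : ℕ) (hn : 1 ≤ n) (x : HypChordal.Space n) (hx : x ∈ HypChordal.unitBall n) :
    (∀ r : ℝ, 0 < r → r < (1 - ‖x‖) / Real.sqrt (2 * (1 + ‖x‖ ^ 2)) →
      -- the two inclusions
      ((↑) : HypChordal.Space n → OnePoint (HypChordal.Space n)) ''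
          HypChordal.hyperbolicBall x (HypChordal.innerRadius x r) ⊆
        HypChordal.chordalBall (x : OnePoint (HypChordal.Space n)) r ∧
      HypChordal.chordalBall (x : OnePoint (HypChordal.Space n)) r ⊆
        ((↑) : HypChordal.Space n → OnePoint (HypChordal.Space n)) ''
          HypChordal.hyperbolicBall x (HypChordal.outerRadius x r) ∧
      -- sharpness: the inner radius is the largest and the outer radius the smallest possible
      IsGreatest {s : ℝ | 0 < s ∧
        ((↑) : HypChordal.Space n → OnePoint (HypChordal.Space n)) ''
            HypChordal.hyperbolicBall x s ⊆
          HypChordal.chordalBall (x : OnePoint (HypChordal.Space n)) r}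
        (HypChordal.innerRadius x r) ∧
      IsLeast {s : ℝ | 0 < s ∧
        HypChordal.chordalBall (x : OnePoint (HypChordal.Space n)) r ⊆
          ((↑) : HypChordal.Space n → OnePoint (HypChordal.Space n)) ''
            HypChordal.hyperbolicBall x s}
        (HypChordal.outerRadius x r)) ∧
    Tendsto (fun r : ℝ => HypChordal.outerRadius x r / HypChordal.innerRadius x r)
      (𝓝[>] 0) (𝓝 1) := by
  have hx1 : ‖x‖ < 1 := by simpa [HypChordal.unitBall] using hx
  refine ⟨fun r hr hr0 => ?_, HypChordal.tendsto_outerRadius_div_innerRadius hx1⟩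
  have h := HypChordal.isChordalDiameter_ends hx1 hr hr0
  have hin := HypChordal.image_hyperbolicBall_subset_chordalBall h
  have hout := HypChordal.chordalBall_subset_image_hyperbolicBall h
  refine ⟨hin, hout, ⟨⟨?_, hin⟩, fun s hs => HypChordal.le_innerRadius_of_subset hn h hs.2⟩,
    ⟨⟨?_, hout⟩, fun s hs => HypChordal.outerRadius_le_of_subset hn h hs.2⟩⟩
  · rw [HypChordal.innerRadius_eq h]
    exact HypChordal.arsinh_sqrt_diamSinhSq_pos h.one_sub_sq_pos h.one_sub_t₁_sq_pos
      (sub_neg.2 h.t₁_lt).ne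
  · rw [HypChordal.outerRadius_eq h]
    exact HypChordal.arsinh_sqrt_diamSinhSq_pos h.one_sub_sq_pos h.one_sub_t₂_sq_pos
      (sub_pos.2 h.lt_t₂).ne'
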